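/- Let $\mathsf X,\mathsf Y$ be finite sets (with their power-set $\sigma$-algebras) and let $K$ be a Markov kernel from $\mathsf X$ to $\mathsf Y$; for a probability measure $\mu$ on $\mathsf X$ put $\mu K(y)=\sum_{x}K(y|x)\mu(x)$. For probability measures $\nu\ll\mu$, let $$D_\alpha(\nu\|\mu)=\frac1{\alpha-1}\log \mathbb E_\mu\Big[\Big(\frac{d\nu}{d\mu}\Big)^{\alpha}\Big]\qquad(\alpha\ge 0,\ \alpha\ne 0,1)$$ be the Rényi divergence of order $\alpha$, extended to $\alpha=0$ and $\alpha=1$ by continuity in $\alpha$, that is $D_0(\nu\|\mu)=-\log\mu\big(\frac{d\nu}{d\mu}>0\big)$ and $D_1=D_{\rm KL}$, and let $\chi^2(\nu\|\mu)=\mathbb E_\mu\big[(\frac{d\nu}{d\mu})^2-1\big]$. For a divergence $D$ let $$\eta_D(K)=\sup\Big\{\frac{D(\nu K\|\mu K)}{D(\nu\|\mu)}:\ \nu\ll\mu \text{ probability measures on }\mathsf X,\ 0<D(\nu\|\mu)<\infty\Big\}$$ (with $\sup\emptyset=0$), and write $\eta_\alpha=\eta_{D_\alpha}$. Theorem. For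 every Markov kernel $K$ and every $\alpha\in(0,1]$, $$\eta_\alpha(K)=\eta_{\chi^2}(K).$$ The equality extends to the boundary order $0$ as a limit: $\lim_{\alpha\to0^+}\eta_\alpha(K)=\eta_{\chi^2}(K)$. For the order-$0$ divergence $D_0$ itself, $\eta_0(K)\le\eta_{\chi^2}(K)$. -/

import Mathlib

open MeasureTheory ProbabilityTheory Filter Topology
open scoped ENNReal

noncomputable section

variable {X Y : Type*} [MeasurableSpace X] [MeasurableSpace Y]

/-- The Rényi divergence `D_α(ν‖μ)` of a probability measure `ν` that is absolutely continuous
with respect to the probability measure `μ`: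
`1 / (α - 1) * log 𝔼_μ[(dν/dμ)^α]` for `α ≠ 0, 1`, and for `α = 0, 1` its continuous extension in
the order, which is `-log μ(dν/dμ > 0)` for `α = 0` and the Kullback-Leibler divergence for `α = 1`.
(The real numbers below are nonnegative for probability measures `ν ≪ μ`, so that `ENNReal.ofReal`
only changes their type.) -/
def renyiDiv (α : ℝ) (ν μ : Measure X) : ℝ≥0∞ :=
  if α = 0 then ENNReal.ofReal (-Real.log (μ.real {x | 0 < ν.rnDeriv μ x}))
  else if α = 1 then InformationTheory.klDiv ν μ
  else ENNReal.ofReal (1 / (α - 1) * Real.log (∫ x, (ν.rnDeriv μ x).toReal ^ α ∂μ))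

/-- The `φ`-divergence `D_φ(ν‖μ) = 𝔼_μ[φ(dν/dμ)]`, for `ν ≪ μ` probability measures and
`φ` convex with `φ 1 = 0` (so that it is nonnegative). -/
def phiDiv (φ : ℝ → ℝ) (ν μ : Measure X) : ℝ≥0∞ :=
  ENNReal.ofReal (∫ x, φ (ν.rnDeriv μ x).toReal ∂μ)

/-- The `χ²`-divergence, i.e. the `φ`-divergence with `φ(t) = t² - 1`. -/
def chiSqDiv (ν μ : Measure X) : ℝ≥0∞ :=
  phiDiv (fun t => t ^ 2 - 1) ν μ

/-- The distribution-dependent SDPI constant `η_D(μ, K)` of a kernel `K` and a divergence, which is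
given as a divergence `DX` on `X` and the same divergence `DY` on `Y`: the supremum of
`D(νK‖μK) / D(ν‖μ)` over all probability measures `ν ≪ μ` with `0 < D(ν‖μ) < ∞`.
Here `νK` is `ν.bind K`, and the supremum over the empty set is `0`. -/
def sdpiConstAt (DX : Measure X → Measure X → ℝ≥0∞) (DY : Measure Y → Measure Y → ℝ≥0∞)
    (μ : ProbabilityMeasure X) (K : Kernel X Y) : ℝ≥0∞ :=
  ⨆ (ν : ProbabilityMeasure X) (_ : (ν : Measure X) ≪ (μ : Measure X))
    (_ : 0 < DX ν μ ∧ DX ν μ < ∞),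
    DY ((ν : Measure X).bind K) ((μ : Measure X).bind K) / DX ν μ

/-- The distribution-independent SDPI constant `η_D(K) = sup_μ η_D(μ, K)`. -/
def sdpiConst (DX : Measure X → Measure X → ℝ≥0∞) (DY : Measure Y → Measure Y → ℝ≥0∞)
    (K : Kernel X Y) : ℝ≥0∞ :=
  ⨆ μ : ProbabilityMeasure X, sdpiConstAt DX DY μ K

/-- The SDPI constant `η_α(K)` of the Rényi divergence of order `α`. -/
def renyiSdpiConst (α : ℝ) (K : Kernel X Y) : ℝ≥0∞ :=
  sdpiConst (renyiDiv α) (renyiDiv α) K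

/-- The SDPI constant `η_{χ²}(K)` of the `χ²`-divergence. -/
def chiSqSdpiConst (K : Kernel X Y) : ℝ≥0∞ :=
  sdpiConst chiSqDiv chiSqDiv K

end

/-! On finite sets everything reduces to probability vectors and a stochastic matrix `k`.

Upper bound: for `0 < α < 1`, the integral formula for `x ^ α` writes one minus the Hellinger
integral as a positive mixture over `t > 0` of the divergences `χ²(p ‖ (p + t q) / (1 + t))`
(`one_div_sub_sum_eq_chiSqSum`, `one_sub_hellingerSum_eq_integral`). Mixing commutes with `k`, so a
`χ²` contraction coefficient `η` valid for all pairs contracts this quantity too. As `η ≤ 1`,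
weighted AM-GM moves the bound under the logarithm (`IsChiSqContraction.mul_log_hellingerSum_le`);
orders `0` and `1` follow as limits.

Lower bound: along the segment from `q` to `p`, `D_α` grows like `(α / 2) χ²(p ‖ q) ε²`
(`tendsto_renyiSum_segment`). The factor `α / 2` is the same before and after applying `k`, so any
Rényi contraction constant also contracts `χ²`. -/

section Discrete

open scoped Matrix

variable {ι κ : Type*} [Fintype ι] [Fintype κ]

/-- The `χ²`-divergence of two vectors on a finite index set. -/
noncomputable def chiSqSum (p q : ι → ℝ) : ℝ := ∑ i, (p i - q i) ^ 2 / q i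

/-- The Hellinger integral `∑ i, q i * (p i / q i) ^ α` of two vectors on a finite index set. -/
noncomputable def hellingerSum (α : ℝ) (p q : ι → ℝ) : ℝ := ∑ i, q i * (p i / q i) ^ α

/-- The Rényi divergence of two vectors on a finite index set. -/
noncomputable def renyiSum (α : ℝ) (p q : ι → ℝ) : ℝ :=
  if α = 0 then -Real.log (∑ i, q i * if 0 < p i then 1 else 0)
  else if α = 1 then ∑ i, q i * InformationTheory.klFun (p i / q i)
  else 1 / (α - 1) * Real.log (hellingerSum α p q)

/-! ### Stochastic matrices and data processing for `χ²` -/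

lemma vecMul_mem_stdSimplex {p : ι → ℝ} (hp : p ∈ stdSimplex ℝ ι) {k : Matrix ι κ ℝ}
    (hk : ∀ i, k i ∈ stdSimplex ℝ κ) : p ᵥ* k ∈ stdSimplex ℝ κ := by
  refine ⟨fun j => Finset.sum_nonneg fun i _ => mul_nonneg (hp.1 i) ((hk i).1 j), ?_⟩
  simp only [Matrix.vecMul, dotProduct]
  rw [Finset.sum_comm]
  simp_rw [← Finset.mul_sum, (hk _).2, mul_one]
  exact hp.2

omit [Fintype κ] in
lemma vecMul_eq_zero_of_eq_zero {p q : ι → ℝ} (hq : ∀ i, 0 ≤ q i)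
    (hpq : ∀ i, q i = 0 → p i = 0) {k : Matrix ι κ ℝ} (hk : ∀ i j, 0 ≤ k i j) (j : κ)
    (h : (q ᵥ* k) j = 0) : (p ᵥ* k) j = 0 := by
  simp only [Matrix.vecMul, dotProduct] at h ⊢
  rw [Finset.sum_eq_zero_iff_of_nonneg fun i _ => mul_nonneg (hq i) (hk i j)] at h
  refine Finset.sum_eq_zero fun i hi => ?_
  rcases mul_eq_zero.1 (h i hi) with h | h <;> simp [h, hpq]

/-- Cauchy-Schwarz for each output letter `j`, then summation over `j` using that the rows of `k`
sum to one. -/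
lemma chiSqSum_vecMul_le {p q : ι → ℝ} (hq : ∀ i, 0 ≤ q i) (hpq : ∀ i, q i = 0 → p i = 0)
    {k : Matrix ι κ ℝ} (hk : ∀ i, k i ∈ stdSimplex ℝ κ) :
    chiSqSum (p ᵥ* k) (q ᵥ* k) ≤ chiSqSum p q := by
  have key : ∀ j, ((p ᵥ* k) j - (q ᵥ* k) j) ^ 2 / (q ᵥ* k) j
      ≤ ∑ i, (p i - q i) ^ 2 / q i * k i j := by
    intro j
    -- The Cauchy-Schwarz step needs positive denominators; the discarded indices contribute zero to
    -- every sum.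
    let s := Finset.univ.filter fun i => 0 < q i * k i j
    have hs : ∀ f : ι → ℝ, (∀ i, q i * k i j = 0 → f i = 0) → ∑ i, f i = ∑ i ∈ s, f i := by
      intro f hf
      refine (Finset.sum_subset (Finset.filter_subset _ _) fun i _ hi => hf i ?_).symm
      refine le_antisymm ?_ (mul_nonneg (hq i) ((hk i).1 j))
      simpa [s] using hi
    have hz : ∀ i, q i * k i j = 0 → (p i - q i) * k i j = 0 := by
      intro i hi
      rcases mul_eq_zero.1 hi with h | h <;> simp [h, hpq]
    have h1 : (p ᵥ* k) j - (q ᵥ* k) j = ∑ i ∈ s, (p i - q i) * k i j := by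
      rw [← hs _ hz]
      simp [Matrix.vecMul, dotProduct, sub_mul]
    have h2 : (q ᵥ* k) j = ∑ i ∈ s, q i * k i j := by
      rw [← hs _ fun _ h => h]
      rfl
    rw [h1, h2, hs]
    · refine (Finset.sq_sum_div_le_sum_sq_div s _ fun i hi => (Finset.mem_filter.1 hi).2).trans ?_
      refine Finset.sum_le_sum fun i hi => le_of_eq ?_
      have h := (Finset.mem_filter.1 hi).2
      have h3 : q i ≠ 0 := by rintro h0; simp [h0] at h
      have h4 : k i j ≠ 0 := by rintro h0; simp [h0] at h
      field_simp
    · intro i hi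
      rcases mul_eq_zero.1 hi with h | h <;> simp [h]
  refine (Finset.sum_le_sum fun j _ => key j).trans (le_of_eq ?_)
  rw [Finset.sum_comm]
  simp_rw [← Finset.mul_sum, (hk _).2, mul_one]
  rfl

lemma chiSqSum_nonneg {p q : ι → ℝ} (hq : ∀ i, 0 ≤ q i) : 0 ≤ chiSqSum p q :=
  Finset.sum_nonneg fun i _ => div_nonneg (sq_nonneg _) (hq i)

/-! ### Hellinger integrals as mixtures of `χ²`-divergences -/

/-- The mixture `(p + t q) / (1 + t)`. -/
noncomputable def mixture (t : ℝ) (p q : ι → ℝ) : ι → ℝ := (1 / (1 + t)) • p + (t / (1 + t)) • q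

lemma mixture_mem_stdSimplex {t : ℝ} (ht : 0 < t) {p q : ι → ℝ} (hp : p ∈ stdSimplex ℝ ι)
    (hq : q ∈ stdSimplex ℝ ι) : mixture t p q ∈ stdSimplex ℝ ι :=
  convex_stdSimplex ℝ ι hp hq (by positivity) (by positivity) (by field_simp)

omit [Fintype ι] in
lemma eq_zero_of_mixture_eq_zero {t : ℝ} (ht : 0 < t) {p q : ι → ℝ} (hp : ∀ i, 0 ≤ p i)
    (hq : ∀ i, 0 ≤ q i) (i : ι) (h : mixture t p q i = 0) : p i = 0 := by
  simp only [mixture, Pi.add_apply, Pi.smul_apply, smul_eq_mul] at h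
  have h1 : 0 ≤ t / (1 + t) * q i := mul_nonneg (by positivity) (hq i)
  have h2 : 0 < 1 / (1 + t) := by positivity
  rcases (hp i).lt_or_eq with h3 | h3
  · nlinarith [mul_pos h2 h3]
  · exact h3.symm

omit [Fintype κ] in
lemma mixture_vecMul (t : ℝ) (p q : ι → ℝ) (k : Matrix ι κ ℝ) :
    mixture t p q ᵥ* k = mixture t (p ᵥ* k) (q ᵥ* k) := by
  simp [mixture, Matrix.add_vecMul, Matrix.smul_vecMul]

/-- The concave function `x / (t + x)` differs from its tangent at `x = 1` by an exact multiple of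
`(x - 1) ^ 2 / (t + x)`. At `x = p i / q i` the denominator is the mixture up to a factor, and the
tangent term sums to zero because `p` and `q` have equal mass. -/
lemma one_div_sub_sum_eq_chiSqSum {t : ℝ} (ht : 0 < t) {p q : ι → ℝ}
    (hp : p ∈ stdSimplex ℝ ι) (hq : q ∈ stdSimplex ℝ ι) (hpq : ∀ i, q i = 0 → p i = 0) :
    1 / (1 + t) - ∑ i, q i * (p i / q i / (t + p i / q i))
      = 1 / (t * (1 + t)) * chiSqSum p (mixture t p q) := by
  have key : ∀ i, q i * (1 / (1 + t)) - q i * (p i / q i / (t + p i / q i))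
      = t / (1 + t) ^ 2 * (q i - p i)
        + 1 / (t * (1 + t)) * ((p i - mixture t p q i) ^ 2 / mixture t p q i) := by
    intro i
    simp only [mixture, Pi.add_apply, Pi.smul_apply, smul_eq_mul]
    rcases (hq.1 i).lt_or_eq with h | h
    · have h1 := hp.1 i
      have h2 : 0 < p i + t * q i := by positivity
      have h3 : t + p i / q i = (p i + t * q i) / q i := by field_simp; ring
      have h4 : 1 / (1 + t) * p i + t / (1 + t) * q i = (p i + t * q i) / (1 + t) := by
        field_simp
      rw [h3, h4]
      field_simp
      ring
    · simp [← h, hpq i h.symm]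
  have hs := Finset.sum_congr (rfl : (Finset.univ : Finset ι) = _) fun i _ => key i
  rw [Finset.sum_sub_distrib, ← Finset.sum_mul, hq.2, one_mul, Finset.sum_add_distrib,
    ← Finset.mul_sum, ← Finset.mul_sum, Finset.sum_sub_distrib, hp.2, hq.2] at hs
  rw [hs, chiSqSum]
  ring

/-- `η` is a contraction coefficient of the stochastic matrix `k` for the `χ²`-divergence. -/
def IsChiSqContraction (η : ℝ) (k : Matrix ι κ ℝ) : Prop :=
  ∀ p ∈ stdSimplex ℝ ι, ∀ q ∈ stdSimplex ℝ ι, (∀ i, q i = 0 → p i = 0) →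
    chiSqSum (p ᵥ* k) (q ᵥ* k) ≤ η * chiSqSum p q

lemma sum_rpowIntegrand_eq {α t : ℝ} (hα : α ∈ Set.Ioo 0 1) (ht : 0 < t) {p q : ι → ℝ}
    (hp : p ∈ stdSimplex ℝ ι) (hq : q ∈ stdSimplex ℝ ι) :
    ∑ i, q i * Real.rpowIntegrand₀₁ α t (p i / q i)
      = t ^ (α - 1) * ∑ i, q i * (p i / q i / (t + p i / q i)) := by
  rw [Finset.mul_sum]
  refine Finset.sum_congr rfl fun i _ => ?_
  rw [Real.rpowIntegrand₀₁_eq_pow_div hα ht.le (div_nonneg (hp.1 i) (hq.1 i))]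
  ring

lemma one_sub_hellingerSum_eq_integral {α : ℝ} (hα : α ∈ Set.Ioo 0 1) {p q : ι → ℝ}
    (hp : p ∈ stdSimplex ℝ ι) (hq : q ∈ stdSimplex ℝ ι) :
    IntegrableOn (fun t => Real.rpowIntegrand₀₁ α t 1
      - ∑ i, q i * Real.rpowIntegrand₀₁ α t (p i / q i)) (Set.Ioi 0) ∧
    1 - hellingerSum α p q = (∫ t in Set.Ioi 0, Real.rpowIntegrand₀₁ α t 1)⁻¹ *
      ∫ t in Set.Ioi 0, (Real.rpowIntegrand₀₁ α t 1
        - ∑ i, q i * Real.rpowIntegrand₀₁ α t (p i / q i)) := by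
  have hi1 := Real.integrableOn_rpowIntegrand₀₁_Ioi hα zero_le_one
  have hi : ∀ i, IntegrableOn (fun t => q i * Real.rpowIntegrand₀₁ α t (p i / q i))
      (Set.Ioi 0) := fun i =>
    (Real.integrableOn_rpowIntegrand₀₁_Ioi hα (div_nonneg (hp.1 i) (hq.1 i))).const_mul _
  have his := integrable_finsetSum Finset.univ fun i _ => hi i
  refine ⟨hi1.sub his, ?_⟩
  rw [integral_sub hi1 his, integral_finsetSum _ fun i _ => hi i, mul_sub, Finset.mul_sum,
    ← Real.rpow_eq_const_mul_integral hα zero_le_one, Real.one_rpow, hellingerSum]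
  congr 1
  refine Finset.sum_congr rfl fun i _ => ?_
  rw [integral_const_mul, Real.rpow_eq_const_mul_integral hα (div_nonneg (hp.1 i) (hq.1 i))]
  ring

lemma IsChiSqContraction.one_sub_hellingerSum_le {η : ℝ} {k : Matrix ι κ ℝ}
    (h : IsChiSqContraction η k) (hk : ∀ i, k i ∈ stdSimplex ℝ κ) {α : ℝ} (hα : α ∈ Set.Ioo 0 1)
    {p q : ι → ℝ} (hp : p ∈ stdSimplex ℝ ι) (hq : q ∈ stdSimplex ℝ ι)
    (hpq : ∀ i, q i = 0 → p i = 0) :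
    1 - hellingerSum α (p ᵥ* k) (q ᵥ* k) ≤ η * (1 - hellingerSum α p q) := by
  have hpk := vecMul_mem_stdSimplex hp hk
  have hqk := vecMul_mem_stdSimplex hq hk
  have hpqk := vecMul_eq_zero_of_eq_zero hq.1 hpq fun i j => (hk i).1 j
  obtain ⟨hi1, h1⟩ := one_sub_hellingerSum_eq_integral hα hp hq
  obtain ⟨hi2, h2⟩ := one_sub_hellingerSum_eq_integral hα hpk hqk
  rw [h1, h2, mul_left_comm, ← integral_const_mul η]
  refine mul_le_mul_of_nonneg_left ?_
    (inv_pos.2 (Real.integral_rpowIntegrand₀₁_one_pos hα)).le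
  refine setIntegral_mono_on hi2 (hi1.const_mul _) measurableSet_Ioi fun t ht => ?_
  have ht : 0 < t := ht
  have ht1 : Real.rpowIntegrand₀₁ α t 1 = t ^ (α - 1) * (1 / (1 + t)) := by
    rw [Real.rpowIntegrand₀₁_eq_pow_div hα ht.le zero_le_one]
    ring
  rw [sum_rpowIntegrand_eq hα ht hp hq, sum_rpowIntegrand_eq hα ht hpk hqk, ht1, ← mul_sub,
    ← mul_sub, one_div_sub_sum_eq_chiSqSum ht hp hq hpq,
    one_div_sub_sum_eq_chiSqSum ht hpk hqk hpqk, ← mixture_vecMul]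
  -- The reference vector is now the mixture, which varies with `t`: this is why `η` must be
  -- independent of the distribution.
  have := h p hp _ (mixture_mem_stdSimplex ht hp hq) (eq_zero_of_mixture_eq_zero ht hp.1 hq.1)
  calc _ ≤ t ^ (α - 1) * (1 / (t * (1 + t)) * (η * chiSqSum p (mixture t p q))) := by gcongr
    _ = _ := by ring

/-! ### From Hellinger integrals to Rényi divergences of orders in `[0, 1]` -/

lemma hellingerSum_pos {α : ℝ} {p q : ι → ℝ} (hp : p ∈ stdSimplex ℝ ι) (hq : ∀ i, 0 ≤ q i)
    (hpq : ∀ i, q i = 0 → p i = 0) : 0 < hellingerSum α p q := by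
  obtain ⟨i, hi⟩ : ∃ i, 0 < p i := by
    by_contra! h
    have := Finset.sum_nonpos fun i (_ : i ∈ Finset.univ) => h i
    rw [hp.2] at this
    linarith
  have hqi : 0 < q i := (hq i).lt_of_ne fun h => hi.ne' (hpq i h.symm)
  exact Finset.sum_pos'
    (fun i _ => mul_nonneg (hq i) (Real.rpow_nonneg (div_nonneg (hp.1 i) (hq i)) _))
    ⟨i, Finset.mem_univ i, mul_pos hqi (Real.rpow_pos_of_pos (div_pos hi hqi) _)⟩

lemma IsChiSqContraction.mul_log_hellingerSum_le {η : ℝ} (hη0 : 0 ≤ η) (hη1 : η ≤ 1)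
    {k : Matrix ι κ ℝ} (h : IsChiSqContraction η k) (hk : ∀ i, k i ∈ stdSimplex ℝ κ)
    {α : ℝ} (hα : α ∈ Set.Ioo 0 1)
    {p q : ι → ℝ} (hp : p ∈ stdSimplex ℝ ι) (hq : q ∈ stdSimplex ℝ ι)
    (hpq : ∀ i, q i = 0 → p i = 0) :
    η * Real.log (hellingerSum α p q) ≤ Real.log (hellingerSum α (p ᵥ* k) (q ᵥ* k)) := by
  have hA := hellingerSum_pos (α := α) hp hq.1 hpq
  have h1 := h.one_sub_hellingerSum_le hk hα hp hq hpq
  -- With `H` the input Hellinger integral, AM-GM gives `H ^ η ≤ (1 - η) + η H`, and `h1` bounds the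
  -- right side by the output integral.
  have h2 := Real.geom_mean_le_arith_mean2_weighted (sub_nonneg.2 hη1) hη0 zero_le_one hA.le
    (by ring)
  rw [Real.one_rpow, one_mul] at h2
  rw [← Real.log_rpow hA]
  exact Real.log_le_log (Real.rpow_pos_of_pos hA _) (by linarith)

lemma tendsto_hellingerSum_zero {p q : ι → ℝ} (hp : ∀ i, 0 ≤ p i) (hq : ∀ i, 0 ≤ q i)
    (hpq : ∀ i, q i = 0 → p i = 0) :
    Tendsto (fun α => hellingerSum α p q) (𝓝[>] 0) (𝓝 (∑ i, q i * if 0 < p i then 1 else 0)) := by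
  refine tendsto_finsetSum _ fun i _ => Tendsto.const_mul _ ?_
  rcases (hp i).lt_or_eq with h | h
  · have hqi : 0 < q i := (hq i).lt_of_ne fun h' => h.ne' (hpq i h'.symm)
    have := (Real.continuous_const_rpow (div_pos h hqi).ne').tendsto 0
    simpa [h] using this.mono_left nhdsWithin_le_nhds
  · refine tendsto_const_nhds.congr' ?_
    filter_upwards [self_mem_nhdsWithin] with α hα
    simp [← h, Real.zero_rpow (ne_of_gt hα)]

/-- The slope of `α ↦ x ^ α` at `1` is `x log x`; the remaining part `1 - x` of `klFun` sums to zero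
against `q`. -/
lemma tendsto_hellingerSum_one {p q : ι → ℝ} (hp : p ∈ stdSimplex ℝ ι) (hq : q ∈ stdSimplex ℝ ι)
    (hpq : ∀ i, q i = 0 → p i = 0) :
    Tendsto (fun α => (1 - α)⁻¹ * (1 - hellingerSum α p q)) (𝓝[<] 1)
      (𝓝 (∑ i, q i * InformationTheory.klFun (p i / q i))) := by
  have key : ∀ i, Tendsto (fun α => q i * ((1 - α)⁻¹ * (p i / q i - (p i / q i) ^ α) + 1
      - p i / q i)) (𝓝[<] 1) (𝓝 (q i * InformationTheory.klFun (p i / q i))) := by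
    intro i
    refine Tendsto.const_mul _ ?_
    rw [InformationTheory.klFun_apply]
    refine Tendsto.sub_const (Tendsto.add_const _ ?_) _
    rcases (div_nonneg (hp.1 i) (hq.1 i)).lt_or_eq with h | h
    · have := (Real.hasStrictDerivAt_const_rpow h 1).hasDerivAt.tendsto_slope
      rw [Real.rpow_one] at this
      refine (this.mono_left (nhdsWithin_mono _ fun x hx => ne_of_lt hx)).congr fun α => ?_
      rw [slope_def_field, Real.rpow_one, ← neg_sub (1 : ℝ) α, ← neg_sub (p i / q i), neg_div_neg_eq,
        div_eq_inv_mul]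
    · rw [← h]
      refine tendsto_const_nhds.congr' ?_
      filter_upwards [Ioo_mem_nhdsLT (zero_lt_one (α := ℝ))] with α hα
      simp [Real.zero_rpow hα.1.ne']
  refine (tendsto_finsetSum Finset.univ fun i _ => key i).congr fun α => ?_
  have h1 : ∀ i, q i * ((1 - α)⁻¹ * (p i / q i - (p i / q i) ^ α) + 1 - p i / q i)
      = (1 - α)⁻¹ * (p i - q i * (p i / q i) ^ α) + (q i - p i) := by
    intro i
    by_cases h : q i = 0
    · simp [h, hpq i h]
    · have : q i * (p i / q i) = p i := by field_simp
      linear_combination ((1 - α)⁻¹ - 1) * this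
  simp_rw [h1]
  rw [Finset.sum_add_distrib, ← Finset.mul_sum, Finset.sum_sub_distrib, Finset.sum_sub_distrib,
    hp.2, hq.2, hellingerSum]
  ring

lemma sum_mul_ite_pos_ne_zero {p q : ι → ℝ} (hp : p ∈ stdSimplex ℝ ι)
    (hq : q ∈ stdSimplex ℝ ι) (hpq : ∀ i, q i = 0 → p i = 0) :
    (∑ i, q i * if 0 < p i then (1 : ℝ) else 0) ≠ 0 := by
  intro h0
  have h1 : ∀ i ∈ Finset.univ, 0 ≤ q i * if 0 < p i then (1 : ℝ) else 0 := fun i _ =>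
    mul_nonneg (hq.1 i) (by split_ifs <;> norm_num)
  rw [Finset.sum_eq_zero_iff_of_nonneg h1] at h0
  have h2 : ∑ i, p i = 0 := Finset.sum_eq_zero fun i hi => by
    by_contra hne
    have hpi : 0 < p i := (hp.1 i).lt_of_ne' hne
    have := h0 i hi
    simp only [hpi, if_true, mul_one] at this
    exact hne (hpq i this)
  rw [hp.2] at h2
  exact one_ne_zero h2

theorem IsChiSqContraction.renyiSum_le {η : ℝ} (hη0 : 0 ≤ η) (hη1 : η ≤ 1)
    {k : Matrix ι κ ℝ} (h : IsChiSqContraction η k) (hk : ∀ i, k i ∈ stdSimplex ℝ κ)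
    {α : ℝ} (hα : α ∈ Set.Icc 0 1)
    {p q : ι → ℝ} (hp : p ∈ stdSimplex ℝ ι) (hq : q ∈ stdSimplex ℝ ι)
    (hpq : ∀ i, q i = 0 → p i = 0) :
    renyiSum α (p ᵥ* k) (q ᵥ* k) ≤ η * renyiSum α p q := by
  have hpk := vecMul_mem_stdSimplex hp hk
  have hqk := vecMul_mem_stdSimplex hq hk
  have hpqk := vecMul_eq_zero_of_eq_zero hq.1 hpq fun i j => (hk i).1 j
  rcases eq_or_ne α 0 with rfl | h0
  · simp only [renyiSum, if_true, mul_neg, neg_le_neg_iff]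
    refine le_of_tendsto_of_tendsto
      (((tendsto_hellingerSum_zero hp.1 hq.1 hpq).log (sum_mul_ite_pos_ne_zero hp hq hpq)).const_mul η)
      ((tendsto_hellingerSum_zero hpk.1 hqk.1 hpqk).log (sum_mul_ite_pos_ne_zero hpk hqk hpqk)) ?_
    filter_upwards [Ioo_mem_nhdsGT (zero_lt_one (α := ℝ))] with α hα
    exact h.mul_log_hellingerSum_le hη0 hη1 hk hα hp hq hpq
  rcases eq_or_ne α 1 with rfl | h1
  · simp only [renyiSum, one_ne_zero, if_false, if_true]
    refine le_of_tendsto_of_tendsto (tendsto_hellingerSum_one hpk hqk hpqk)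
      ((tendsto_hellingerSum_one hp hq hpq).const_mul η) ?_
    filter_upwards [Ioo_mem_nhdsLT (zero_lt_one (α := ℝ))] with α hα
    -- At order `1` the Hellinger inequality is passed to the limit directly, without the logarithm.
    rw [mul_left_comm]
    exact mul_le_mul_of_nonneg_left (h.one_sub_hellingerSum_le hk hα hp hq hpq)
      (inv_nonneg.2 (sub_nonneg.2 hα.2.le))
  · have hα' : α ∈ Set.Ioo 0 1 := ⟨hα.1.lt_of_ne' h0, hα.2.lt_of_ne h1⟩
    simp only [renyiSum, h0, h1, if_false]
    rw [mul_left_comm]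
    refine mul_le_mul_of_nonpos_left (h.mul_log_hellingerSum_le hη0 hη1 hk hα' hp hq hpq) ?_
    exact one_div_nonpos.2 (sub_nonpos.2 hα.2)

/-! ### Second-order behaviour of Rényi divergences along segments -/

lemma tendsto_div_sq_of_hasDerivAt {f f' : ℝ → ℝ} {c : ℝ}
    (hf : ∀ᶠ x in 𝓝 0, HasDerivAt f (f' x) x) (h0 : f 0 = 0) (h0' : f' 0 = 0)
    (hf' : HasDerivAt f' c 0) :
    Tendsto (fun x => f x / x ^ 2) (𝓝[>] 0) (𝓝 (c / 2)) := by
  have hc : Tendsto f (𝓝 0) (𝓝 0) := by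
    simpa [h0] using hf.self_of_nhds.continuousAt.tendsto
  -- L'Hôpital is applied once; the limit of `f' x / (2 x)` is then a slope at `0`, so `f'` need
  -- only be differentiable there.
  refine HasDerivAt.lhopital_zero_nhdsGT (f' := f') (g' := fun x => 2 * x)
    (hf.filter_mono nhdsWithin_le_nhds) (Eventually.of_forall fun x => ?_) ?_
    (hc.mono_left nhdsWithin_le_nhds) ?_ ?_
  · simpa using hasDerivAt_pow 2 x
  · filter_upwards [self_mem_nhdsWithin] with x hx
    exact mul_ne_zero two_ne_zero (ne_of_gt hx)
  · have : Tendsto (fun x : ℝ => x ^ 2) (𝓝 0) (𝓝 (0 ^ 2)) := (continuous_pow 2).tendsto 0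
    rw [zero_pow two_ne_zero] at this
    exact this.mono_left nhdsWithin_le_nhds
  · have := (hf'.tendsto_slope.mono_left
      (nhdsWithin_mono _ fun x (hx : 0 < x) => ne_of_gt hx)).div_const 2
    refine this.congr fun x => ?_
    rw [slope_def_field, h0', sub_zero, sub_zero, div_div, mul_comm]

omit [Fintype ι] in
lemma mul_comp_segment_div (f : ℝ → ℝ) (p q : ι → ℝ) (ε : ℝ) (i : ι) :
    q i * f (((1 - ε) • q + ε • p) i / q i) = q i * f (1 + ε * (p i / q i - 1)) := by
  by_cases h : q i = 0
  · simp [h]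
  · congr 2
    simp only [Pi.add_apply, Pi.smul_apply, smul_eq_mul]
    field_simp
    ring

lemma sum_mul_div_sub_one {p q : ι → ℝ} (hp : p ∈ stdSimplex ℝ ι) (hq : q ∈ stdSimplex ℝ ι)
    (hpq : ∀ i, q i = 0 → p i = 0) : ∑ i, q i * (p i / q i - 1) = 0 := by
  have h : ∀ i, q i * (p i / q i - 1) = p i - q i := by
    intro i
    by_cases h : q i = 0
    · simp [h, hpq i h]
    · field_simp
  simp_rw [h]
  rw [Finset.sum_sub_distrib, hp.2, hq.2, sub_self]

lemma sum_mul_div_sub_one_sq {p q : ι → ℝ} :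
    ∑ i, q i * (p i / q i - 1) ^ 2 = chiSqSum p q := by
  refine Finset.sum_congr rfl fun i _ => ?_
  by_cases h : q i = 0
  · simp [h]
  · field_simp

/-- The value and first derivative at `ε = 0` vanish, the latter since `p - q` has total mass zero.
The second derivative is `α χ²(p ‖ q)`: at order `1` from `log' 1 = 1`, otherwise from `G'' 0 / (α -
1)`. -/
theorem tendsto_renyiSum_segment {α : ℝ} (hα : 0 < α) {p q : ι → ℝ}
    (hp : p ∈ stdSimplex ℝ ι) (hq : q ∈ stdSimplex ℝ ι) (hpq : ∀ i, q i = 0 → p i = 0) :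
    Tendsto (fun ε : ℝ => renyiSum α ((1 - ε) • q + ε • p) q / ε ^ 2) (𝓝[>] 0)
      (𝓝 (α / 2 * chiSqSum p q)) := by
  set a : ι → ℝ := fun i => p i / q i - 1 with ha
  have hlin : ∀ i (ε : ℝ), HasDerivAt (fun ε => 1 + ε * a i) (a i) ε := fun i ε => by
    simpa using ((hasDerivAt_id ε).mul_const (a i)).const_add 1
  have hpos : ∀ᶠ ε in 𝓝 (0 : ℝ), ∀ i, 0 < 1 + ε * a i := by
    rw [eventually_all]
    intro i
    have := (hlin i 0).continuousAt.tendsto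
    exact this.eventually (lt_mem_nhds (by simp))
  have hsum : ∀ {f : ℝ → ℝ} {f' : ℝ}, HasDerivAt f f' 1 →
      HasDerivAt (fun ε => ∑ i, q i * a i * f (1 + ε * a i)) (∑ i, q i * a i ^ 2 * f') 0 := by
    intro f f' hf
    refine HasDerivAt.fun_sum fun i _ => ?_
    have hf0 : HasDerivAt f f' (1 + 0 * a i) := by simpa using hf
    exact ((hf0.comp (0 : ℝ) (hlin i 0)).const_mul (q i * a i)).congr_deriv (by ring)
  rcases eq_or_ne α 1 with rfl | h1
  · simp only [renyiSum, one_ne_zero, if_false, if_true, mul_comp_segment_div]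
    have hmain := tendsto_div_sq_of_hasDerivAt
      (f := fun ε => ∑ i, q i * InformationTheory.klFun (1 + ε * a i))
      (f' := fun ε => ∑ i, q i * a i * Real.log (1 + ε * a i)) (c := chiSqSum p q) ?_ ?_ ?_ ?_
    · convert hmain using 2
      ring
    · filter_upwards [hpos] with ε hε
      refine HasDerivAt.fun_sum fun i _ => ?_
      have hkl := InformationTheory.hasDerivAt_klFun (hε i).ne'
      have hcomp := (hkl.comp ε (hlin i ε)).const_mul (q i)
      exact hcomp.congr_deriv (by ring)
    · simp [InformationTheory.klFun]
    · simp
    · refine (hsum (Real.hasDerivAt_log one_ne_zero)).congr_deriv ?_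
      simp [← sum_mul_div_sub_one_sq, ha]
  · simp only [renyiSum, hα.ne', h1, if_false, hellingerSum,
      mul_comp_segment_div (fun x => x ^ α)]
    set G : ℝ → ℝ := fun ε => ∑ i, q i * (1 + ε * a i) ^ α with hG
    set G' : ℝ → ℝ := fun ε => α * ∑ i, q i * a i * (1 + ε * a i) ^ (α - 1) with hG'
    have hG0 : G 0 = 1 := by simp [hG, hq.2]
    have hG'0 : G' 0 = 0 := by simp [hG', ha, sum_mul_div_sub_one hp hq hpq]
    have hGd : ∀ᶠ ε in 𝓝 0, HasDerivAt G (G' ε) ε := by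
      filter_upwards [hpos] with ε hε
      simp only [hG', Finset.mul_sum]
      refine HasDerivAt.fun_sum fun i _ => ?_
      exact (((hlin i ε).rpow_const (p := α) (Or.inl (hε i).ne')).const_mul (q i)).congr_deriv
        (by ring)
    have hGd' : HasDerivAt G' (α * ((α - 1) * chiSqSum p q)) 0 := by
      refine HasDerivAt.const_mul α ?_
      refine (hsum (Real.hasDerivAt_rpow_const (p := α - 1) (Or.inl one_ne_zero))).congr_deriv ?_
      rw [← Finset.sum_mul, sum_mul_div_sub_one_sq]
      simp [mul_comm]
    have hGpos : ∀ᶠ ε in 𝓝 0, G ε ≠ 0 := by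
      have := hGd.self_of_nhds.continuousAt.tendsto
      exact this.eventually (isOpen_ne.mem_nhds (by rw [hG0]; exact one_ne_zero))
    have hmain := tendsto_div_sq_of_hasDerivAt
      (f := fun ε => 1 / (α - 1) * Real.log (G ε))
      (f' := fun ε => 1 / (α - 1) * (G' ε / G ε)) (c := α * chiSqSum p q) ?_ ?_ ?_ ?_
    · convert hmain using 2
      ring
    · filter_upwards [hGd, hGpos] with ε h h'
      exact (h.log h').const_mul _
    · simp [hG0]
    · simp [hG'0]
    · refine ((hGd'.div hGd.self_of_nhds hGpos.self_of_nhds).const_mul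
        (1 / (α - 1))).congr_deriv ?_
      have := sub_ne_zero.2 h1
      rw [hG0, hG'0]
      field_simp
      ring

end Discrete

/-! ### Translation between measures and probability vectors -/

section FiniteSpace

open scoped Matrix

variable {X Y : Type*} [MeasurableSpace X] [MeasurableSpace Y] [MeasurableSingletonClass X]
  [MeasurableSingletonClass Y]

/-- The probability vector of a measure. -/
noncomputable def massVector (μ : Measure X) : X → ℝ := fun x => μ.real {x}

/-- The stochastic matrix of a kernel. -/
noncomputable def kernelMatrix (K : Kernel X Y) : Matrix X Y ℝ := fun x y => (K x).real {y}

lemma massVector_mem_stdSimplex [Fintype X] (μ : Measure X) [IsProbabilityMeasure μ] :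
    massVector μ ∈ stdSimplex ℝ X := by
  refine ⟨fun x => measureReal_nonneg, ?_⟩
  simp [massVector, sum_measureReal_singleton]

omit [MeasurableSingletonClass X] in
lemma kernelMatrix_mem_stdSimplex [Fintype Y] (K : Kernel X Y) [IsMarkovKernel K] (x : X) :
    kernelMatrix K x ∈ stdSimplex ℝ Y := massVector_mem_stdSimplex (K x)

omit [MeasurableSingletonClass X] in
lemma massVector_eq_zero_of_absolutelyContinuous {ν μ : Measure X} [IsFiniteMeasure μ]
    (h : ν ≪ μ) (x : X) (hx : massVector μ x = 0) : massVector ν x = 0 := by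
  have : μ {x} = 0 := (measureReal_eq_zero_iff).1 hx
  simp [massVector, measureReal_def, h this]

omit [MeasurableSingletonClass X] in
lemma absolutelyContinuous_of_massVector [Countable X] {ν μ : Measure X} [IsFiniteMeasure ν]
    (h : ∀ x, massVector μ x = 0 → massVector ν x = 0) : ν ≪ μ := by
  intro s hs
  rw [← Set.biUnion_of_singleton s, measure_biUnion_null_iff s.to_countable]
  intro x hx
  refine (measureReal_eq_zero_iff).1 (h x ?_)
  simp [massVector, measureReal_def, measure_mono_null (Set.singleton_subset_iff.2 hx) hs]

lemma toReal_rnDeriv_eq_div {ν μ : Measure X} [IsFiniteMeasure μ] [IsFiniteMeasure ν]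
    (h : ν ≪ μ) {x : X} (hx : massVector μ x ≠ 0) :
    (ν.rnDeriv μ x).toReal = massVector ν x / massVector μ x := by
  have := Measure.setLIntegral_rnDeriv h {x}
  rw [lintegral_singleton] at this
  rw [eq_div_iff hx, massVector, massVector, measureReal_def, measureReal_def, ← this,
    ENNReal.toReal_mul]

lemma integral_comp_rnDeriv [Fintype X] {ν μ : Measure X} [IsFiniteMeasure μ] [IsFiniteMeasure ν]
    (h : ν ≪ μ) (f : ℝ → ℝ) :
    ∫ x, f (ν.rnDeriv μ x).toReal ∂μ
      = ∑ x, massVector μ x * f (massVector ν x / massVector μ x) := by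
  rw [integral_fintype .of_finite]
  refine Finset.sum_congr rfl fun x _ => ?_
  by_cases hx : massVector μ x = 0
  · rw [hx, zero_mul]
    exact mul_eq_zero_of_left hx _
  · rw [toReal_rnDeriv_eq_div h hx]
    rfl

lemma massVector_bind [Fintype X] (ν : Measure X) [IsFiniteMeasure ν] (K : Kernel X Y)
    [IsFiniteKernel K] : massVector (ν.bind K) = massVector ν ᵥ* kernelMatrix K := by
  ext y
  rw [massVector, measureReal_def, Measure.bind_apply (measurableSet_singleton y)
    K.measurable.aemeasurable, lintegral_fintype, ENNReal.toReal_sum fun x _ =>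
      ENNReal.mul_ne_top (measure_ne_top _ _) (measure_ne_top _ _)]
  refine Finset.sum_congr rfl fun x _ => ?_
  rw [ENNReal.toReal_mul, mul_comm]
  rfl

lemma exists_massVector_eq [Fintype X] {p : X → ℝ} (hp : p ∈ stdSimplex ℝ X) :
    ∃ μ : ProbabilityMeasure X, massVector (μ : Measure X) = p := by
  have h1 : ∑ x, ENNReal.ofReal (p x) = 1 := by
    rw [← ENNReal.ofReal_sum_of_nonneg fun x _ => hp.1 x, hp.2, ENNReal.ofReal_one]
  refine ⟨⟨(PMF.ofFintype _ h1).toMeasure, inferInstance⟩, ?_⟩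
  ext x
  simp only [massVector, measureReal_def, ProbabilityMeasure.coe_mk]
  rw [PMF.toMeasure_apply_singleton _ _ (measurableSet_singleton x), PMF.ofFintype_apply,
    ENNReal.toReal_ofReal (hp.1 x)]

lemma chiSqDiv_eq_ofReal [Fintype X] {ν μ : Measure X} [IsProbabilityMeasure μ]
    [IsProbabilityMeasure ν] (h : ν ≪ μ) :
    chiSqDiv ν μ = ENNReal.ofReal (chiSqSum (massVector ν) (massVector μ)) := by
  rw [chiSqDiv, phiDiv, integral_comp_rnDeriv h fun t => t ^ 2 - 1, ← sum_mul_div_sub_one_sq]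
  congr 1
  have := sum_mul_div_sub_one (massVector_mem_stdSimplex ν) (massVector_mem_stdSimplex μ)
    (massVector_eq_zero_of_absolutelyContinuous h)
  -- `x ^ 2 - 1` and `(x - 1) ^ 2` differ by `2 (x - 1)`, whose mean is zero.
  rw [← sub_eq_zero, ← Finset.sum_sub_distrib, ← mul_zero (2 : ℝ), ← this, Finset.mul_sum]
  exact Finset.sum_congr rfl fun x _ => by ring

lemma renyiDiv_eq_ofReal [Fintype X] (α : ℝ) {ν μ : Measure X} [IsProbabilityMeasure μ]
    [IsProbabilityMeasure ν] (h : ν ≪ μ) :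
    renyiDiv α ν μ = ENNReal.ofReal (renyiSum α (massVector ν) (massVector μ)) := by
  unfold renyiDiv renyiSum
  split_ifs with h0 h1
  · congr 3
    have hmeas : MeasurableSet {x | 0 < ν.rnDeriv μ x} := Set.toFinite _ |>.measurableSet
    rw [← integral_indicator_one hmeas, integral_fintype .of_finite]
    refine Finset.sum_congr rfl fun x _ => ?_
    change massVector μ x * _ = _
    by_cases hx : massVector μ x = 0
    · simp [hx]
    · congr 1
      have h2 := Measure.setLIntegral_rnDeriv h {x}
      rw [lintegral_singleton] at h2
      have h3 : 0 < massVector ν x ↔ 0 < ν.rnDeriv μ x := by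
        have h4 : μ {x} ≠ 0 := fun h => hx ((measureReal_eq_zero_iff).2 h)
        rw [massVector, measureReal_def, ENNReal.toReal_pos_iff, ← h2,
          and_iff_left (ENNReal.mul_lt_top_iff.2 ?_), CanonicallyOrderedAdd.mul_pos,
          and_iff_left (pos_iff_ne_zero.2 h4)]
        left
        refine ⟨lt_top_iff_ne_top.2 fun htop => ?_, measure_lt_top _ _⟩
        rw [htop, ENNReal.top_mul h4] at h2
        exact measure_ne_top ν {x} h2.symm
      simp [Set.indicator_apply, h3]
  · rw [InformationTheory.klDiv_eq_integral_klFun, if_pos ⟨h, .of_finite⟩,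
      integral_comp_rnDeriv h]
  · rw [integral_comp_rnDeriv h fun t => t ^ α]
    rfl

lemma bind_absolutelyContinuous [Finite X] [Finite Y] {ν μ : Measure X}
    [IsProbabilityMeasure μ] [IsProbabilityMeasure ν] (h : ν ≪ μ)
    (K : Kernel X Y) [IsMarkovKernel K] : ν.bind K ≪ μ.bind K := by
  cases nonempty_fintype X
  cases nonempty_fintype Y
  refine absolutelyContinuous_of_massVector fun y hy => ?_
  rw [massVector_bind] at hy ⊢
  exact vecMul_eq_zero_of_eq_zero (massVector_mem_stdSimplex μ).1
    (massVector_eq_zero_of_absolutelyContinuous h)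
    (fun x => (kernelMatrix_mem_stdSimplex K x).1) y hy

/-! ### Comparison of the contraction constants -/

omit [MeasurableSingletonClass X] [MeasurableSingletonClass Y] in
lemma sdpiConst_le_of_forall_le_mul {DX : Measure X → Measure X → ℝ≥0∞}
    {DY : Measure Y → Measure Y → ℝ≥0∞} {K : Kernel X Y} {η : ℝ≥0∞}
    (h : ∀ ν μ : ProbabilityMeasure X, (ν : Measure X) ≪ μ →
      DY ((ν : Measure X).bind K) ((μ : Measure X).bind K) ≤ η * DX ν μ) :
    sdpiConst DX DY K ≤ η :=
  iSup_le fun μ => iSup_le fun ν => iSup_le fun hac => iSup_le fun _ =>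
    ENNReal.div_le_of_le_mul (h ν μ hac)

omit [MeasurableSingletonClass X] [MeasurableSingletonClass Y] in
lemma le_sdpiConst_mul {DX : Measure X → Measure X → ℝ≥0∞}
    {DY : Measure Y → Measure Y → ℝ≥0∞} {K : Kernel X Y} {ν μ : ProbabilityMeasure X}
    (hac : (ν : Measure X) ≪ μ) (h0 : 0 < DX ν μ) (h1 : DX ν μ < ∞) :
    DY ((ν : Measure X).bind K) ((μ : Measure X).bind K) ≤ sdpiConst DX DY K * DX ν μ := by
  rw [← ENNReal.div_le_iff h0.ne' h1.ne]
  refine le_trans ?_ (le_iSup (fun μ => sdpiConstAt DX DY μ K) μ)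
  exact le_iSup_of_le ν (le_iSup_of_le hac (le_iSup_of_le ⟨h0, h1⟩ le_rfl))

variable (K : Kernel X Y) [IsMarkovKernel K]

/-- Used both for finiteness, which allows passing to a real coefficient, and for the AM-GM step. -/
lemma chiSqSdpiConst_le_one [Finite X] [Finite Y] : chiSqSdpiConst K ≤ 1 := by
  cases nonempty_fintype X
  cases nonempty_fintype Y
  refine sdpiConst_le_of_forall_le_mul fun ν μ hac => ?_
  rw [one_mul, chiSqDiv_eq_ofReal hac, chiSqDiv_eq_ofReal (bind_absolutelyContinuous hac K),
    massVector_bind, massVector_bind]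
  exact ENNReal.ofReal_le_ofReal (chiSqSum_vecMul_le (massVector_mem_stdSimplex _).1
    (massVector_eq_zero_of_absolutelyContinuous hac) (kernelMatrix_mem_stdSimplex K))

lemma isChiSqContraction_chiSqSdpiConst [Fintype X] [Fintype Y] :
    IsChiSqContraction (chiSqSdpiConst K).toReal (kernelMatrix K) := by
  intro p hp q hq hpq
  obtain ⟨ν, rfl⟩ := exists_massVector_eq hp
  obtain ⟨μ, rfl⟩ := exists_massVector_eq hq
  have hac : (ν : Measure X) ≪ μ := absolutelyContinuous_of_massVector hpq
  have hη : chiSqSdpiConst K ≠ ∞ := ne_top_of_le_ne_top ENNReal.one_ne_top (chiSqSdpiConst_le_one K)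
  have hnn := chiSqSum_nonneg (p := massVector (ν : Measure X)) hq.1
  rcases hnn.lt_or_eq with h | h
  · have hX := chiSqDiv_eq_ofReal hac
    have hmain := le_sdpiConst_mul (DX := chiSqDiv) (DY := chiSqDiv) (K := K) hac
      (by rw [hX]; exact ENNReal.ofReal_pos.2 h) (by rw [hX]; exact ENNReal.ofReal_lt_top)
    rw [hX, chiSqDiv_eq_ofReal (bind_absolutelyContinuous hac K), massVector_bind,
      massVector_bind] at hmain
    change _ ≤ chiSqSdpiConst K * _ at hmain
    rw [← ENNReal.ofReal_toReal hη, ← ENNReal.ofReal_mul ENNReal.toReal_nonneg] at hmain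
    exact (ENNReal.ofReal_le_ofReal_iff (mul_nonneg ENNReal.toReal_nonneg hnn)).1 hmain
  -- Pairs with zero divergence are outside the supremum; data processing settles them.
  · have := chiSqSum_vecMul_le hq.1 hpq (kernelMatrix_mem_stdSimplex K)
    rwa [← h, mul_zero] at *

theorem renyiSdpiConst_le_chiSqSdpiConst [Finite X] [Finite Y] {α : ℝ} (hα : α ∈ Set.Icc 0 1) :
    renyiSdpiConst α K ≤ chiSqSdpiConst K := by
  cases nonempty_fintype X
  cases nonempty_fintype Y
  have h1 := chiSqSdpiConst_le_one K
  have hη : chiSqSdpiConst K ≠ ∞ := ne_top_of_le_ne_top ENNReal.one_ne_top h1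
  refine sdpiConst_le_of_forall_le_mul fun ν μ hac => ?_
  rw [renyiDiv_eq_ofReal α hac, renyiDiv_eq_ofReal α (bind_absolutelyContinuous hac K),
    massVector_bind, massVector_bind, ← ENNReal.ofReal_toReal hη,
    ← ENNReal.ofReal_mul ENNReal.toReal_nonneg]
  exact ENNReal.ofReal_le_ofReal ((isChiSqContraction_chiSqSdpiConst K).renyiSum_le
    ENNReal.toReal_nonneg (ENNReal.toReal_le_of_le_ofReal zero_le_one (by simpa using h1))
    (kernelMatrix_mem_stdSimplex K) hα (massVector_mem_stdSimplex _) (massVector_mem_stdSimplex _)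
    (massVector_eq_zero_of_absolutelyContinuous hac))

theorem chiSqSdpiConst_le_renyiSdpiConst [Finite X] [Finite Y] {α : ℝ} (hα : 0 < α) :
    chiSqSdpiConst K ≤ renyiSdpiConst α K := by
  cases nonempty_fintype X
  cases nonempty_fintype Y
  rcases eq_or_ne (renyiSdpiConst α K) ∞ with htop | htop
  · rw [htop]
    exact le_top
  refine sdpiConst_le_of_forall_le_mul fun ν μ hac => ?_
  rw [chiSqDiv_eq_ofReal hac, chiSqDiv_eq_ofReal (bind_absolutelyContinuous hac K),
    massVector_bind, massVector_bind, ← ENNReal.ofReal_toReal htop,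
    ← ENNReal.ofReal_mul ENNReal.toReal_nonneg]
  refine ENNReal.ofReal_le_ofReal ?_
  set p := massVector (ν : Measure X)
  set q := massVector (μ : Measure X)
  set k := kernelMatrix K
  have hk : ∀ x, k x ∈ stdSimplex ℝ Y := kernelMatrix_mem_stdSimplex K
  have hp : p ∈ stdSimplex ℝ X := massVector_mem_stdSimplex _
  have hq : q ∈ stdSimplex ℝ X := massVector_mem_stdSimplex _
  have hpq : ∀ x, q x = 0 → p x = 0 := massVector_eq_zero_of_absolutelyContinuous hac
  rcases (chiSqSum_nonneg (p := p) hq.1).lt_or_eq with hpos | hzero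
  swap
  · have := chiSqSum_vecMul_le hq.1 hpq hk
    rwa [← hzero, mul_zero] at *
  have hX := tendsto_renyiSum_segment hα hp hq hpq
  have hY := tendsto_renyiSum_segment hα (vecMul_mem_stdSimplex hp hk)
    (vecMul_mem_stdSimplex hq hk) (vecMul_eq_zero_of_eq_zero hq.1 hpq fun x => (hk x).1)
  have hlim := le_of_tendsto_of_tendsto hY (hX.const_mul (renyiSdpiConst α K).toReal) ?_
  · rw [mul_left_comm] at hlim
    exact le_of_mul_le_mul_left hlim (by positivity)
  -- A positive limit makes the input divergence positive for small `ε`, so the perturbed pair is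
  -- admissible in the supremum.
  have hev := hX.eventually (lt_mem_nhds (show 0 < α / 2 * chiSqSum p q by positivity))
  filter_upwards [hev, Ioo_mem_nhdsGT (zero_lt_one (α := ℝ))] with ε hε hε1
  have hε2 : 0 < ε ^ 2 := pow_pos hε1.1 2
  have hd : 0 < renyiSum α ((1 - ε) • q + ε • p) q := (div_pos_iff_of_pos_right hε2).1 hε
  obtain ⟨ρ, hρ⟩ := exists_massVector_eq (convex_stdSimplex ℝ X hq hp (sub_nonneg.2 hε1.2.le)
    hε1.1.le (by ring))
  have hρac : (ρ : Measure X) ≪ μ := absolutelyContinuous_of_massVector fun x hx => by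
    rw [hρ]
    simp [show q x = 0 from hx, hpq x hx]
  have hDX := renyiDiv_eq_ofReal α hρac
  have hmain := le_sdpiConst_mul (DX := renyiDiv α) (DY := renyiDiv α) (K := K) hρac
    (by rw [hDX, hρ]; exact ENNReal.ofReal_pos.2 hd) (by rw [hDX]; exact ENNReal.ofReal_lt_top)
  rw [hDX, renyiDiv_eq_ofReal α (bind_absolutelyContinuous hρac K), massVector_bind,
    massVector_bind, hρ, Matrix.add_vecMul, Matrix.smul_vecMul, Matrix.smul_vecMul] at hmain
  change _ ≤ renyiSdpiConst α K * _ at hmain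
  rw [← ENNReal.ofReal_toReal htop, ← ENNReal.ofReal_mul ENNReal.toReal_nonneg] at hmain
  rw [← mul_div_assoc]
  gcongr
  exact (ENNReal.ofReal_le_ofReal_iff (mul_nonneg ENNReal.toReal_nonneg hd.le)).1 hmain

end FiniteSpace

theorem mainTheorem2 {X Y : Type*}
    [Finite X] [MeasurableSpace X] [MeasurableSingletonClass X]
    [Finite Y] [MeasurableSpace Y] [MeasurableSingletonClass Y]
    (K : Kernel X Y) [IsMarkovKernel K] :
    (∀ α : ℝ, 0 < α → α ≤ 1 → renyiSdpiConst α K = chiSqSdpiConst K) ∧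
    Tendsto (fun α : ℝ => renyiSdpiConst α K) (𝓝[>] 0) (𝓝 (chiSqSdpiConst K)) ∧
    renyiSdpiConst 0 K ≤ chiSqSdpiConst K := by
  have h : ∀ α : ℝ, 0 < α → α ≤ 1 → renyiSdpiConst α K = chiSqSdpiConst K := fun α h0 h1 =>
    le_antisymm (renyiSdpiConst_le_chiSqSdpiConst K ⟨h0.le, h1⟩)
      (chiSqSdpiConst_le_renyiSdpiConst K h0)
  refine ⟨h, tendsto_const_nhds.congr' ?_, renyiSdpiConst_le_chiSqSdpiConst K (by simp)⟩
  filter_upwards [Ioo_mem_nhdsGT (zero_lt_one (α := ℝ))] with α hα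
  exact (h α hα.1 hα.2.le).symm
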